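/- For a real $n\times n$ matrix $A$ and $x\in\mathbb{R}^n$, let $A[x]$ denote the matrix $A$ with its diagonal replaced by $x$; let $\mathrm{diag}(A)\in\mathbb{R}^n$ be the diagonal of $A$, and let $\mathrm{vecl}(A)\in\mathbb{R}^{n(n-1)/2}$ be the vector of its entries strictly below the diagonal. A correlation matrix is a symmetric positive semidefinite real matrix with unit diagonal. For a non-singular correlation matrix $C=Q\,\mathrm{diag}(\lambda_1,\dots,\lambda_n)Q'$ with $Q$ orthogonal, let $\log C=Q\,\mathrm{diag}(\log\lambda_1,\dots,\log\lambda_n)Q'$ and $\gamma(C)=\mathrm{vecl}(\log C)$. (a) Let $A\in\mathbb{R}^{n\times n}$ be symmetric. There is a unique vector $x^{\ast}\in\mathbb{R}^n$ such that $e^{A[x^{\ast}]}$ is a correlation matrix, and for every initial vector $x_{(0)}\in\mathbb{R}^n$ the sequence $$x_{(k+1)}=x_{(k)}-\log\mathrm{diag}\bigl(e^{A[x_{(k)}]}\bigr),\qquad k=0,1,2,\ldots,$$ where the logarithm is applied element-wise to the vector of diagonal elements, converges to $x^{\ast}$. (b) Consequently the iteration reconstructs $C$ from $\gamma$: for every $\gamma\in\mathbb{R}^{n(n-1)/2}$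 there is a unique non-singular $n\times n$ correlation matrix $C$ with $\gamma(C)=\gamma$, and for every symmetric $A$ with $\mathrm{vecl}(A)=\gamma$ and every $x_{(0)}\in\mathbb{R}^n$, the sequence in (a) satisfies $e^{A[x_{(k)}]}\to C$ as $k\to\infty$. -/

import Mathlib

open Filter Topology

/-- A correlation matrix: a (symmetric) positive semidefinite real matrix with unit diagonal. -/
def IsCorrelationMatrix {n : ℕ} (C : Matrix (Fin n) (Fin n) ℝ) : Prop :=
  C.PosSemidef ∧ ∀ i, C i i = 1

/-- The set of non-singular `n × n` correlation matrices. -/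
def nonsingularCorrelationMatrices (n : ℕ) : Set (Matrix (Fin n) (Fin n) ℝ) :=
  {C | IsCorrelationMatrix C ∧ C.det ≠ 0}

/-- `A[x]`: the matrix `A` where the vector `x` has replaced its diagonal. -/
def replaceDiag {n : ℕ} (A : Matrix (Fin n) (Fin n) ℝ) (x : Fin n → ℝ) :
    Matrix (Fin n) (Fin n) ℝ :=
  Matrix.of fun i j => if i = j then x i else A i j

/-- The map `g(x) = x - log diag(e^{A[x]})`, with the logarithm applied element-wise. -/
noncomputable def diagStep {n : ℕ} (A : Matrix (Fin n) (Fin n) ℝ) (x : Fin n → ℝ) : Fin n → ℝ :=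
  fun i => x i - Real.log (NormedSpace.exp (replaceDiag A x) i i)

/-- The positions strictly below the diagonal of an `n × n` matrix; there are `n(n-1)/2` of
them. -/
abbrev LowerIndex (n : ℕ) : Type := {p : Fin n × Fin n // p.2 < p.1}

/-- `vecl A`: the lower off-diagonal elements of `A`, as a vector indexed by their positions. -/
def vecl {n : ℕ} (A : Matrix (Fin n) (Fin n) ℝ) : LowerIndex n → ℝ :=
  fun p => A p.1.1 p.1.2

/-- The logarithm of a real matrix via the spectral calculus: if `C = Q diag(λ) Qᵀ` is symmetric
positive definite with `Q` orthogonal, then this is `Q diag(log λ) Qᵀ`. -/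
noncomputable def matrixLog {n : ℕ} (C : Matrix (Fin n) (Fin n) ℝ) : Matrix (Fin n) (Fin n) ℝ :=
  cfc Real.log C

/-- The parametrization `γ(C) = vecl(log C)`. -/
noncomputable def gammaParam {n : ℕ} (C : Matrix (Fin n) (Fin n) ℝ) : LowerIndex n → ℝ :=
  vecl (matrixLog C)

/-! The solutions of `diag e^{A[x]} = 1` are the critical points of the potential `φ(x) = tr
e^{A[x]} - ∑ xᵢ`, and the iteration descends it. With `δ = diag e^{A[x]}`, Golden–Thompson for
`A[x]` and `diag(-log δ)` shows that one step lowers `φ` by at least `∑ (δᵢ - 1 - log δᵢ)`, which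
vanishes only at `δ = 1`. Klein's inequality bounds `φ` below by `∑ (e^{xᵢ} - xᵢ)`, so sublevel sets
are compact, and its equality case makes the solution unique. Hence every orbit has cluster points,
all equal to that solution, and converges; the same argument gives existence. Part (b) follows
because `exp` and `log` are inverse between symmetric and positive definite matrices. -/

/-- The Lie–Trotter product formula in a Banach algebra. -/
theorem tendsto_exp_mul_exp_pow {𝔸 : Type*} [NormedRing 𝔸] [NormOneClass 𝔸] [NormedAlgebra ℝ 𝔸]
    [CompleteSpace 𝔸] (a b : 𝔸) :
    Tendsto (fun m : ℕ => (NormedSpace.exp ((m : ℝ)⁻¹ • a) * NormedSpace.exp ((m : ℝ)⁻¹ • b)) ^ m)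
      atTop (𝓝 (NormedSpace.exp (a + b))) := by
  let : NormedAlgebra ℚ 𝔸 := .restrictScalars ℚ ℝ 𝔸
  -- Both curves have derivative `a + b` at 0, so they differ by `o(1/m)` at `t = 1/m`.
  have hd : HasDerivAt (fun t : ℝ => NormedSpace.exp (t • a) * NormedSpace.exp (t • b) -
      NormedSpace.exp (t • (a + b))) 0 0 := by
    have h := ((hasDerivAt_exp_smul_const (𝕂 := ℝ) a (0 : ℝ)).mul
      (hasDerivAt_exp_smul_const (𝕂 := ℝ) b (0 : ℝ))).sub
      (hasDerivAt_exp_smul_const (𝕂 := ℝ) (a + b) (0 : ℝ))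
    simp only [zero_smul, NormedSpace.exp_zero, mul_one, one_mul, sub_self] at h
    exact h
  have ho := hasDerivAt_iff_tendsto_slope_zero.1 hd
  have hinv : Tendsto (fun m : ℕ => (m : ℝ)⁻¹) atTop (𝓝[≠] 0) := by
    refine tendsto_nhdsWithin_iff.2 ⟨tendsto_inv_atTop_nhds_zero_nat, ?_⟩
    filter_upwards [eventually_gt_atTop 0] with m hm
    simp [hm.ne']
  have h1 := (ho.comp hinv).norm
  simp only [Function.comp_def, zero_add, inv_inv, zero_smul, NormedSpace.exp_zero, mul_one,
    sub_self, sub_zero, norm_zero] at h1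
  have hexp : ∀ c : 𝔸, ‖NormedSpace.exp c‖ ≤ Real.exp ‖c‖ := fun c => by
    rw [Real.exp_eq_exp_ℝ, NormedSpace.exp_eq_tsum ℝ]
    refine tsum_of_norm_bounded (NormedSpace.exp_series_hasSum_exp' (𝕂 := ℝ) ‖c‖) fun n => ?_
    rw [norm_smul, Real.norm_of_nonneg (by positivity), smul_eq_mul]
    gcongr
    exact norm_pow_le _ _
  -- Telescoping loses only a factor of order `m`, which the `o(1/m)` gap absorbs.
  have htel : ∀ (x y : 𝔸) (M : ℝ), 0 ≤ M → ‖x‖ ≤ M → ‖y‖ ≤ M → ∀ m : ℕ,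
      ‖x ^ (m + 1) - y ^ (m + 1)‖ ≤ (m + 1) * M ^ m * ‖x - y‖ := by
    intro x y M hM hx hy m
    induction m with
    | zero => simp
    | succ m ih =>
      have he : x ^ (m + 1 + 1) - y ^ (m + 1 + 1) =
          x * (x ^ (m + 1) - y ^ (m + 1)) + (x - y) * y ^ (m + 1) := by
        rw [pow_succ' x (m + 1), pow_succ' y (m + 1)]; noncomm_ring
      have h2 : ‖y ^ (m + 1)‖ ≤ M ^ (m + 1) :=
        (norm_pow_le _ _).trans (pow_le_pow_left₀ (norm_nonneg _) hy _)
      calc _ ≤ ‖x * (x ^ (m + 1) - y ^ (m + 1))‖ + ‖(x - y) * y ^ (m + 1)‖ := by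
            rw [he]; exact norm_add_le _ _
        _ ≤ ‖x‖ * ‖x ^ (m + 1) - y ^ (m + 1)‖ + ‖x - y‖ * ‖y ^ (m + 1)‖ :=
            add_le_add (norm_mul_le _ _) (norm_mul_le _ _)
        _ ≤ M * ((m + 1) * M ^ m * ‖x - y‖) + ‖x - y‖ * M ^ (m + 1) := by gcongr
        _ = _ := by push_cast; ring
  rw [tendsto_iff_norm_sub_tendsto_zero]
  have h3 := h1.const_mul (Real.exp (‖a‖ + ‖b‖))
  rw [mul_zero] at h3
  refine squeeze_zero' (Eventually.of_forall fun _ => norm_nonneg _) ?_ h3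
  filter_upwards [eventually_gt_atTop 0] with m hm
  obtain ⟨k, rfl⟩ := Nat.exists_eq_succ_of_ne_zero hm.ne'
  set t : ℝ := ((k.succ : ℕ) : ℝ)⁻¹ with ht
  have ht0 : 0 ≤ t := by positivity
  have htm : ((k.succ : ℕ) : ℝ) * t = 1 := mul_inv_cancel₀ (by positivity)
  set M := Real.exp (t * (‖a‖ + ‖b‖)) with hM
  have hM1 : 1 ≤ M := Real.one_le_exp (by positivity)
  have hx : ‖NormedSpace.exp (t • a) * NormedSpace.exp (t • b)‖ ≤ M := by
    calc _ ≤ Real.exp ‖t • a‖ * Real.exp ‖t • b‖ :=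
          (norm_mul_le _ _).trans (mul_le_mul (hexp _) (hexp _) (norm_nonneg _) (Real.exp_nonneg _))
      _ = M := by rw [← Real.exp_add, norm_smul, norm_smul, Real.norm_of_nonneg ht0, hM]; ring_nf
  have hy : ‖NormedSpace.exp (t • (a + b))‖ ≤ M := by
    refine (hexp _).trans (Real.exp_le_exp.2 ?_)
    rw [norm_smul, Real.norm_of_nonneg ht0]
    exact mul_le_mul_of_nonneg_left (norm_add_le _ _) ht0
  have hyp : NormedSpace.exp (t • (a + b)) ^ (k + 1) = NormedSpace.exp (a + b) := by
    rw [← NormedSpace.exp_nsmul, ← Nat.cast_smul_eq_nsmul ℝ, smul_smul, htm, one_smul]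
  have hMp : M ^ k ≤ Real.exp (‖a‖ + ‖b‖) := by
    calc M ^ k ≤ M ^ (k + 1) := pow_le_pow_right₀ hM1 (Nat.le_succ k)
      _ = _ := by
        rw [hM, ← Real.exp_nat_mul]
        congr 1
        rw [← mul_assoc, htm, one_mul]
  have h := htel _ _ M (by positivity) hx hy k
  rw [hyp] at h
  refine h.trans ?_
  rw [norm_smul, Real.norm_of_nonneg (by positivity)]
  calc _ ≤ ((k : ℝ) + 1) * Real.exp (‖a‖ + ‖b‖) * _ := by gcongr
    _ = _ := by push_cast; ring

/-! ### Trace inequalities and Golden–Thompson -/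

namespace Matrix

variable {ι : Type*} [Fintype ι]

theorem trace_mul_transpose_eq_sum_sq (X : Matrix ι ι ℝ) : (X * Xᵀ).trace = ∑ i, ∑ j, X i j ^ 2 := by
  simp [trace, mul_apply, sq]

/-- Expand the squared Frobenius norm of `X - Yᵀ`. -/
theorem two_mul_trace_mul_le (X Y : Matrix ι ι ℝ) :
    2 * (X * Y).trace ≤ (X * Xᵀ).trace + (Y * Yᵀ).trace := by
  have h : 0 ≤ ((X - Yᵀ) * (X - Yᵀ)ᵀ).trace := by
    rw [trace_mul_transpose_eq_sum_sq]; positivity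
  have h1 : (Yᵀ * Xᵀ).trace = (X * Y).trace := by rw [← transpose_mul, trace_transpose]
  have h2 : (Yᵀ * Y).trace = (Y * Yᵀ).trace := trace_mul_comm _ _
  simp only [transpose_sub, transpose_transpose, sub_mul, mul_sub, trace_sub, h1, h2] at h
  linarith

theorem trace_mul_pow_comm [DecidableEq ι] (X Y : Matrix ι ι ℝ) (m : ℕ) :
    ((X * Y) ^ m).trace = ((Y * X) ^ m).trace := by
  cases m with
  | zero => simp
  | succ m =>
    have h : (X * Y) ^ (m + 1) = X * ((Y * X) ^ m * Y) := by
      induction m with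
      | zero => simp
      | succ m ih => rw [pow_succ', ih, pow_succ']; simp only [mul_assoc]
    rw [h, trace_mul_comm, mul_assoc, ← pow_succ]

/-- Two trace inequalities for powers of two, proved by a simultaneous induction. -/
theorem trace_two_pow_le [DecidableEq ι] (k : ℕ) :
    (∀ X : Matrix ι ι ℝ, (X ^ 2 ^ (k + 1)).trace ≤ ((X * Xᵀ) ^ 2 ^ k).trace) ∧
    ∀ P Q : Matrix ι ι ℝ, P.IsSymm → Q.IsSymm →
      ((P * Q) ^ 2 ^ k).trace ≤ (P ^ 2 ^ k * Q ^ 2 ^ k).trace := by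
  induction k with
  | zero =>
    refine ⟨fun X => ?_, fun P Q _ _ => by simp⟩
    have := two_mul_trace_mul_le X X
    simp only [zero_add, pow_one, pow_zero, sq]
    linarith
  | succ k ih =>
    obtain ⟨ihA, ihB⟩ := ih
    constructor
    -- Apply the first inequality to `X * X`, cycle to a product of the symmetric `X * Xᵀ` and `Xᵀ *
    -- X`, and split it by the second; powers of these two have equal traces.
    · intro X
      have hP : (Xᵀ * X).IsSymm := by simp [IsSymm, transpose_mul]
      have hQ : (X * Xᵀ).IsSymm := by simp [IsSymm, transpose_mul]
      calc (X ^ 2 ^ (k + 1 + 1)).trace = ((X * X) ^ 2 ^ (k + 1)).trace := by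
            rw [← sq, ← pow_mul, ← pow_succ']
        _ ≤ ((X * X * (X * X)ᵀ) ^ 2 ^ k).trace := ihA _
        _ = ((X * (X * Xᵀ * Xᵀ)) ^ 2 ^ k).trace := by simp only [transpose_mul, mul_assoc]
        _ = ((X * Xᵀ * (Xᵀ * X)) ^ 2 ^ k).trace := by
            rw [trace_mul_pow_comm]; simp only [mul_assoc]
        _ ≤ ((X * Xᵀ) ^ 2 ^ k * (Xᵀ * X) ^ 2 ^ k).trace := ihB _ _ hQ hP
        _ ≤ ((X * Xᵀ) ^ 2 ^ (k + 1)).trace := by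
            have h := two_mul_trace_mul_le ((X * Xᵀ) ^ 2 ^ k) ((Xᵀ * X) ^ 2 ^ k)
            rw [transpose_pow, transpose_pow, hP.eq, hQ.eq, ← sq, ← sq, ← pow_mul, ← pow_mul,
              ← pow_succ, trace_mul_pow_comm Xᵀ] at h
            linarith
    · intro P Q hP hQ
      have hP2 : (P ^ 2).IsSymm := hP.pow 2
      have hQ2 : (Q ^ 2).IsSymm := hQ.pow 2
      calc ((P * Q) ^ 2 ^ (k + 1)).trace ≤ ((P * Q * (P * Q)ᵀ) ^ 2 ^ k).trace := ihA _
        _ = ((P * (Q * Q * P)) ^ 2 ^ k).trace := by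
            rw [transpose_mul, hP.eq, hQ.eq]; simp only [mul_assoc]
        _ = ((P ^ 2 * Q ^ 2) ^ 2 ^ k).trace := by
            rw [trace_mul_pow_comm, mul_assoc, trace_mul_pow_comm, sq, sq]
        _ ≤ _ := ihB _ _ hP2 hQ2
        _ = _ := by rw [← pow_mul, ← pow_mul, ← pow_succ']

theorem continuous_exp [DecidableEq ι] :
    Continuous (NormedSpace.exp : Matrix ι ι ℝ → Matrix ι ι ℝ) := by
  let : NormedRing (Matrix ι ι ℝ) := Matrix.linftyOpNormedRing
  let : NormedAlgebra ℝ (Matrix ι ι ℝ) := Matrix.linftyOpNormedAlgebra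
  let : NormedAlgebra ℚ (Matrix ι ι ℝ) := .restrictScalars ℚ ℝ _
  exact NormedSpace.exp_continuous

theorem tendsto_exp_mul_exp_pow [DecidableEq ι] (A B : Matrix ι ι ℝ) :
    Tendsto (fun m : ℕ => (NormedSpace.exp ((m : ℝ)⁻¹ • A) * NormedSpace.exp ((m : ℝ)⁻¹ • B)) ^ m)
      atTop (𝓝 (NormedSpace.exp (A + B))) := by
  rcases isEmpty_or_nonempty ι with h | h
  · simp only [Subsingleton.elim _ (0 : Matrix ι ι ℝ)]
    exact tendsto_const_nhds
  · let : NormedRing (Matrix ι ι ℝ) := Matrix.linftyOpNormedRing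
    let : NormedAlgebra ℝ (Matrix ι ι ℝ) := Matrix.linftyOpNormedAlgebra
    have : NormOneClass (Matrix ι ι ℝ) := Matrix.linfty_opNormOneClass
    exact _root_.tendsto_exp_mul_exp_pow A B

/-- The Golden–Thompson inequality for real symmetric matrices. -/
theorem trace_exp_add_le [DecidableEq ι] {A B : Matrix ι ι ℝ} (hA : A.IsSymm) (hB : B.IsSymm) :
    (NormedSpace.exp (A + B)).trace ≤ (NormedSpace.exp A * NormedSpace.exp B).trace := by
  -- Restrict Lie–Trotter to `m = 2 ^ k`, where the trace inequality is available; its right side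
  -- does not depend on `k`.
  have h1 := (tendsto_exp_mul_exp_pow A B).comp
    (tendsto_pow_atTop_atTop_of_one_lt (r := 2) (by norm_num))
  have h2 := ((continuous_id.matrix_trace).tendsto _).comp h1
  refine le_of_tendsto' h2 fun k => ?_
  have hroot : ∀ C : Matrix ι ι ℝ,
      NormedSpace.exp (((2 ^ k : ℕ) : ℝ)⁻¹ • C) ^ 2 ^ k = NormedSpace.exp C := fun C => by
    rw [← Matrix.exp_nsmul, ← Nat.cast_smul_eq_nsmul ℝ, smul_smul,
      mul_inv_cancel₀ (by positivity), one_smul]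
  have h := (trace_two_pow_le k).2 _ _ (IsSymm.exp (hA.smul ((2 ^ k : ℕ) : ℝ)⁻¹))
    (IsSymm.exp (hB.smul ((2 ^ k : ℕ) : ℝ)⁻¹))
  rwa [hroot, hroot] at h

/-! ### Spectral decomposition, Klein's inequality, exponential and logarithm -/

variable [DecidableEq ι]

theorem exp_pi_real {κ : Type*} [Finite κ] (d : κ → ℝ) : NormedSpace.exp d = fun i => Real.exp (d i) := by
  ext i
  rw [Pi.coe_exp, Real.exp_eq_exp_ℝ]

theorem IsSymm.exists_spectral {A : Matrix ι ι ℝ} (hA : A.IsSymm) :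
    ∃ (U : Matrix ι ι ℝ) (d : ι → ℝ), U * Uᵀ = 1 ∧ Uᵀ * U = 1 ∧ A = U * diagonal d * Uᵀ ∧
      NormedSpace.exp A = U * diagonal (fun i => Real.exp (d i)) * Uᵀ := by
  have hH : A.IsHermitian := by rwa [IsHermitian, conjTranspose_eq_transpose_of_trivial]
  have hstar : star (hH.eigenvectorUnitary : Matrix ι ι ℝ) =
      (hH.eigenvectorUnitary : Matrix ι ι ℝ)ᵀ := by
    rw [star_eq_conjTranspose, conjTranspose_eq_transpose_of_trivial]
  have h1 := Unitary.coe_mul_star_self hH.eigenvectorUnitary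
  have h2 := Unitary.coe_star_mul_self hH.eigenvectorUnitary
  have h3 := hH.spectral_theorem
  rw [Unitary.conjStarAlgAut_apply] at h3
  rw [Unitary.coe_star] at h1
  rw [hstar] at h1 h2 h3
  set U := (hH.eigenvectorUnitary : Matrix ι ι ℝ)
  refine ⟨U, hH.eigenvalues, h1, h2, h3, ?_⟩
  have hinv : U⁻¹ = Uᵀ := inv_eq_right_inv h1
  have hU : IsUnit U := IsUnit.of_mul_eq_one _ h1
  conv_lhs => rw [h3, ← hinv]
  rw [exp_conj _ _ hU, exp_diagonal, hinv]
  congr 3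
  exact exp_pi_real _

theorem trace_diagonal_mul_conj_diagonal (W : Matrix ι ι ℝ) (a b : ι → ℝ) :
    (diagonal a * (W * diagonal b * Wᵀ)).trace = ∑ i, ∑ j, W i j ^ 2 * (a i * b j) := by
  refine Finset.sum_congr rfl fun i _ => ?_
  rw [diag_apply, diagonal_mul, mul_apply, Finset.mul_sum]
  refine Finset.sum_congr rfl fun j _ => ?_
  rw [mul_diagonal, transpose_apply]
  ring

/-- Klein's inequality for the exponential: the trace exponential lies above its tangent planes,
and touches them only at the point of tangency. -/
theorem klein_exp {A B : Matrix ι ι ℝ} (hA : A.IsSymm) (hB : B.IsSymm) :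
    (NormedSpace.exp A).trace + (NormedSpace.exp A * (B - A)).trace ≤ (NormedSpace.exp B).trace ∧
    ((NormedSpace.exp B).trace ≤ (NormedSpace.exp A).trace + (NormedSpace.exp A * (B - A)).trace →
      A = B) := by
  obtain ⟨U, a, hU1, hU2, hAU, hAe⟩ := hA.exists_spectral
  obtain ⟨V, b, hV1, hV2, hBV, hBe⟩ := hB.exists_spectral
  set W := Uᵀ * V with hW
  have hWt : Wᵀ = Vᵀ * U := by rw [hW, transpose_mul, transpose_transpose]
  have hW1 : W * Wᵀ = 1 := by
    rw [hWt, hW, Matrix.mul_assoc, ← Matrix.mul_assoc V, hV1, Matrix.one_mul, hU2]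
  -- The weights `W i j ^ 2` turn all traces into sums over pairs of eigenvalues, reducing the claim
  -- to `1 + t ≤ e^t` at `t = b j - a i`.
  have hconj : ∀ f g : ι → ℝ, (U * diagonal f * Uᵀ * (V * diagonal g * Vᵀ)).trace =
      ∑ i, ∑ j, W i j ^ 2 * (f i * g j) := fun f g => by
    rw [← trace_diagonal_mul_conj_diagonal, hWt, hW, Matrix.mul_assoc, Matrix.mul_assoc,
      trace_mul_comm]
    simp only [Matrix.mul_assoc]
  have hone : (1 : Matrix ι ι ℝ) = V * diagonal (fun _ => 1) * Vᵀ := by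
    rw [diagonal_one, Matrix.mul_one, hV1]
  have hone' : (1 : Matrix ι ι ℝ) = U * diagonal (fun _ => 1) * Uᵀ := by
    rw [diagonal_one, Matrix.mul_one, hU1]
  have e1 : (NormedSpace.exp A).trace = ∑ i, ∑ j, W i j ^ 2 * (Real.exp (a i) * 1) := by
    rw [← hconj, ← hone, Matrix.mul_one, hAe]
  have e2 : (NormedSpace.exp B).trace = ∑ i, ∑ j, W i j ^ 2 * (1 * Real.exp (b j)) := by
    rw [← hconj, ← hone', Matrix.one_mul, hBe]
  have e3 : (NormedSpace.exp A * B).trace = ∑ i, ∑ j, W i j ^ 2 * (Real.exp (a i) * b j) := by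
    rw [← hconj, ← hAe, ← hBV]
  have e4 : (NormedSpace.exp A * A).trace =
      ∑ i, ∑ j, W i j ^ 2 * (Real.exp (a i) * a i * 1) := by
    rw [← hconj, ← hone, Matrix.mul_one, ← diagonal_mul_diagonal]
    congr 1
    conv_lhs => rw [hAe, hAU]
    simp only [Matrix.mul_assoc]
    rw [← Matrix.mul_assoc Uᵀ U, hU2, Matrix.one_mul]
  have hdiff : (NormedSpace.exp B).trace -
      ((NormedSpace.exp A).trace + (NormedSpace.exp A * (B - A)).trace) =
      ∑ i, ∑ j, W i j ^ 2 * (Real.exp (a i) * (Real.exp (b j - a i) - (b j - a i + 1))) := by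
    rw [Matrix.mul_sub, trace_sub, e1, e2, e3, e4]
    simp only [← Finset.sum_sub_distrib, ← Finset.sum_add_distrib]
    refine Finset.sum_congr rfl fun i _ => Finset.sum_congr rfl fun j _ => ?_
    rw [Real.exp_sub]
    field_simp
    ring
  have hnn : ∀ i j, 0 ≤ W i j ^ 2 * (Real.exp (a i) * (Real.exp (b j - a i) - (b j - a i + 1))) :=
    fun i j => mul_nonneg (sq_nonneg _) (mul_nonneg (Real.exp_nonneg _)
      (sub_nonneg.2 (Real.add_one_le_exp _)))
  refine ⟨?_, fun hle => ?_⟩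
  · rw [← sub_nonneg, hdiff]
    exact Finset.sum_nonneg fun i _ => Finset.sum_nonneg fun j _ => hnn i j
  · have hzero : ∑ i, ∑ j, W i j ^ 2 *
        (Real.exp (a i) * (Real.exp (b j - a i) - (b j - a i + 1))) = 0 :=
      le_antisymm (by linarith) (Finset.sum_nonneg fun i _ => Finset.sum_nonneg fun j _ => hnn i j)
    -- Each vanishing term forces `W i j = 0` or `a i = b j`.
    have hcomm : diagonal a * W = W * diagonal b := by
      ext i j
      rw [diagonal_mul, mul_diagonal]
      have h1 := (Finset.sum_eq_zero_iff_of_nonneg fun i _ =>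
        Finset.sum_nonneg fun j _ => hnn i j).1 hzero i (Finset.mem_univ i)
      have h2 := (Finset.sum_eq_zero_iff_of_nonneg fun j _ => hnn i j).1 h1 j (Finset.mem_univ j)
      rcases mul_eq_zero.1 h2 with h | h
      · rw [pow_eq_zero_iff two_ne_zero] at h
        rw [h]; ring
      · have h3 := (mul_eq_zero.1 h).resolve_left (Real.exp_ne_zero _)
        have h4 : b j - a i = 0 := by
          by_contra hne
          have := Real.add_one_lt_exp hne
          linarith
        rw [sub_eq_zero.1 h4]; ring
    calc A = U * (diagonal a * (W * Wᵀ)) * Uᵀ := by rw [hW1, Matrix.mul_one, hAU]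
      _ = U * (W * diagonal b * Wᵀ) * Uᵀ := by rw [← Matrix.mul_assoc (diagonal a), hcomm]
      _ = (U * Uᵀ) * V * diagonal b * Vᵀ * (U * Uᵀ) := by
          rw [hWt, hW]; simp only [Matrix.mul_assoc]
      _ = B := by rw [hU1, Matrix.one_mul, Matrix.mul_one, hBV]

theorem IsSymm.posDef_exp {A : Matrix ι ι ℝ} (hA : A.IsSymm) : (NormedSpace.exp A).PosDef := by
  obtain ⟨U, a, hU1, hU2, -, hAe⟩ := hA.exists_spectral
  rw [hAe]
  have hU : IsUnit U := IsUnit.of_mul_eq_one _ hU1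
  have := (PosDef.diagonal (R := ℝ) (d := fun i => Real.exp (a i)) fun i => Real.exp_pos _)
  rw [← conjTranspose_eq_transpose_of_trivial]
  exact (IsUnit.posDef_star_right_conjugate_iff hU).2 this

theorem IsSymm.log_exp {A : Matrix ι ι ℝ} (hA : A.IsSymm) :
    cfc Real.log (NormedSpace.exp A) = A := by
  have hH : IsSelfAdjoint A := by
    rwa [IsSelfAdjoint, star_eq_conjTranspose, conjTranspose_eq_transpose_of_trivial]
  let : NormedRing (Matrix ι ι ℝ) := Matrix.instL2OpNormedRing
  let : NormedAlgebra ℝ (Matrix ι ι ℝ) := Matrix.instL2OpNormedAlgebra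
  exact CFC.log_exp A hH

theorem PosDef.exp_log {A : Matrix ι ι ℝ} (hA : A.PosDef) :
    NormedSpace.exp (cfc Real.log A) = A := by
  let : NormedRing (Matrix ι ι ℝ) := Matrix.instL2OpNormedRing
  let : NormedAlgebra ℝ (Matrix ι ι ℝ) := Matrix.instL2OpNormedAlgebra
  have hH : IsSelfAdjoint A := hA.1
  have hpos : ∀ x ∈ spectrum ℝ A, 0 < x := by
    rw [hA.1.spectrum_real_eq_range_eigenvalues]
    rintro _ ⟨i, rfl⟩
    exact hA.eigenvalues_pos i
  have hlog : IsSelfAdjoint (cfc Real.log A) := cfc_predicate _ A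
  rw [← CFC.real_exp_eq_normedSpace_exp hlog, ← cfc_comp' Real.exp Real.log A (by fun_prop)
    (Real.continuousOn_log.mono fun x hx => (hpos x hx).ne')]
  conv_rhs => rw [← cfc_id (R := ℝ) A]
  exact cfc_congr fun x hx => Real.exp_log (hpos x hx)

end Matrix

/-! ### The potential and convergence of the iteration -/

variable {n : ℕ} {A : Matrix (Fin n) (Fin n) ℝ}

theorem replaceDiag_isSymm (hA : A.IsSymm) (x : Fin n → ℝ) : (replaceDiag A x).IsSymm := by
  refine Matrix.IsSymm.ext fun i j => ?_
  simp only [replaceDiag, Matrix.of_apply, eq_comm (a := j)]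
  split_ifs with h
  · rw [h]
  · exact hA.apply i j

theorem replaceDiag_add (A : Matrix (Fin n) (Fin n) ℝ) (x d : Fin n → ℝ) :
    replaceDiag A (x + d) = replaceDiag A x + Matrix.diagonal d := by
  ext i j
  by_cases h : i = j <;> simp [replaceDiag, h]

theorem replaceDiag_injective (A : Matrix (Fin n) (Fin n) ℝ) : Function.Injective (replaceDiag A) :=
  fun x y h => by
    ext i
    simpa [replaceDiag] using congrFun (congrFun h i) i

theorem continuous_replaceDiag (A : Matrix (Fin n) (Fin n) ℝ) : Continuous (replaceDiag A) := by
  refine continuous_matrix fun i j => ?_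
  by_cases h : i = j
  · simpa [replaceDiag, h] using continuous_apply j
  · simpa [replaceDiag, h] using continuous_const

theorem continuous_exp_replaceDiag (A : Matrix (Fin n) (Fin n) ℝ) :
    Continuous fun x => NormedSpace.exp (replaceDiag A x) :=
  Matrix.continuous_exp.comp (continuous_replaceDiag A)

theorem exp_replaceDiag_diag_pos (hA : A.IsSymm) (x : Fin n → ℝ) (i : Fin n) :
    0 < NormedSpace.exp (replaceDiag A x) i i :=
  (replaceDiag_isSymm hA x).posDef_exp.diag_pos

theorem isCorrelationMatrix_exp_replaceDiag_iff (hA : A.IsSymm) (x : Fin n → ℝ) :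
    IsCorrelationMatrix (NormedSpace.exp (replaceDiag A x)) ↔
      ∀ i, NormedSpace.exp (replaceDiag A x) i i = 1 :=
  ⟨fun h => h.2, fun h => ⟨(replaceDiag_isSymm hA x).posDef_exp.posSemidef, h⟩⟩

/-- The potential `tr e^{A[x]} - ∑ xᵢ`, whose critical points are the solutions of
`diag e^{A[x]} = 1`. -/
noncomputable def diagPotential (A : Matrix (Fin n) (Fin n) ℝ) (x : Fin n → ℝ) : ℝ :=
  (NormedSpace.exp (replaceDiag A x)).trace - ∑ i, x i

theorem continuous_diagPotential (A : Matrix (Fin n) (Fin n) ℝ) : Continuous (diagPotential A) :=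
  (continuous_exp_replaceDiag A).matrix_trace.sub (by fun_prop)

theorem trace_mul_diagonal (M : Matrix (Fin n) (Fin n) ℝ) (d : Fin n → ℝ) :
    (M * Matrix.diagonal d).trace = ∑ i, M i i * d i := by
  simp [Matrix.trace, Matrix.mul_diagonal]

/-- Golden–Thompson along a diagonal perturbation: the iteration decreases the potential. -/
theorem diagPotential_diagStep_le (hA : A.IsSymm) (x : Fin n → ℝ) :
    diagPotential A (diagStep A x) ≤ diagPotential A x -
      ∑ i, (NormedSpace.exp (replaceDiag A x) i i - 1 -
        Real.log (NormedSpace.exp (replaceDiag A x) i i)) := by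
  set δ : Fin n → ℝ := fun i => NormedSpace.exp (replaceDiag A x) i i with hδ
  have hpos : ∀ i, 0 < δ i := exp_replaceDiag_diag_pos hA x
  have hstep : diagStep A x = x + fun i => -Real.log (δ i) := by
    ext i; simp [diagStep, hδ, sub_eq_add_neg]
  have hgt := Matrix.trace_exp_add_le (replaceDiag_isSymm hA x)
    (Matrix.isSymm_diagonal fun i => -Real.log (δ i))
  rw [← replaceDiag_add, Matrix.exp_diagonal, trace_mul_diagonal] at hgt
  have hone : ∀ i, NormedSpace.exp (replaceDiag A x) i i *
      NormedSpace.exp (fun i => -Real.log (δ i)) i = 1 := fun i => by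
    rw [Matrix.exp_pi_real]
    beta_reduce
    rw [Real.exp_neg, Real.exp_log (hpos i)]
    exact mul_inv_cancel₀ (hpos i).ne'
  simp only [hone] at hgt
  have htr : (NormedSpace.exp (replaceDiag A x)).trace = ∑ i, δ i := rfl
  rw [diagPotential, diagPotential, hstep, htr]
  simp only [Pi.add_apply, Finset.sum_add_distrib, Finset.sum_sub_distrib, Finset.sum_neg_distrib]
  linarith

/-- Coercivity of the potential. -/
theorem sum_exp_sub_le_diagPotential (hA : A.IsSymm) (x : Fin n → ℝ) :
    ∑ i, (Real.exp (x i) - x i) ≤ diagPotential A x := by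
  -- Tangent at `diagonal x`: the difference has zero diagonal, so the linear term drops out.
  have h := (Matrix.klein_exp (Matrix.isSymm_diagonal x) (replaceDiag_isSymm hA x)).1
  rw [Matrix.exp_diagonal, Matrix.exp_pi_real, Matrix.trace_mul_comm, trace_mul_diagonal,
    Matrix.trace_diagonal] at h
  have hz : ∀ i, (replaceDiag A x - Matrix.diagonal x) i i = 0 := fun i => by simp [replaceDiag]
  simp only [hz, zero_mul, Finset.sum_const_zero, add_zero] at h
  rw [diagPotential, Finset.sum_sub_distrib]
  linarith

theorem isCompact_diagPotential_le (hA : A.IsSymm) (c : ℝ) :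
    IsCompact {x | diagPotential A x ≤ c} := by
  refine (isCompact_Icc (a := fun _ : Fin n => -c) (b := fun _ => c)).of_isClosed_subset
    (isClosed_le (continuous_diagPotential A) continuous_const) fun x hx => ?_
  have h := (sum_exp_sub_le_diagPotential hA x).trans hx
  have hi : ∀ i, Real.exp (x i) - x i ≤ c := fun i =>
    (Finset.single_le_sum (f := fun i => Real.exp (x i) - x i)
      (fun j _ => by have := Real.add_one_le_exp (x j); linarith) (Finset.mem_univ i)).trans h
  refine ⟨fun i => ?_, fun i => ?_⟩
  · have := hi i; have := Real.exp_pos (x i)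
    show -c ≤ x i
    linarith
  · have := hi i
    -- For `t ≥ 0`, `e^t - t ≥ 1 + t²/2 ≥ t`.
    have h2 := Real.quadratic_le_exp_of_nonneg (x := |x i|) (abs_nonneg _)
    show x i ≤ c
    rcases le_total 0 (x i) with h0 | h0
    · rw [abs_of_nonneg h0] at h2
      nlinarith [sq_nonneg (x i - 1)]
    · have := Real.exp_pos (x i)
      linarith

theorem eq_of_exp_replaceDiag_diag_eq_one (hA : A.IsSymm) {x y : Fin n → ℝ}
    (hx : ∀ i, NormedSpace.exp (replaceDiag A x) i i = 1)
    (hy : ∀ i, NormedSpace.exp (replaceDiag A y) i i = 1) : x = y := by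
  have key : ∀ x y : Fin n → ℝ, (∀ i, NormedSpace.exp (replaceDiag A x) i i = 1) →
      (NormedSpace.exp (replaceDiag A x) * (replaceDiag A y - replaceDiag A x)).trace =
        ∑ i, (y i - x i) := fun x y hx => by
    have : replaceDiag A y = replaceDiag A x + Matrix.diagonal (y - x) := by
      rw [← replaceDiag_add, add_sub_cancel]
    rw [this, add_sub_cancel_left, trace_mul_diagonal]
    simp [hx]
  -- The linear terms in the two directions are opposite, so equality holds in Klein.
  have hxy := Matrix.klein_exp (replaceDiag_isSymm hA x) (replaceDiag_isSymm hA y)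
  have hyx := (Matrix.klein_exp (replaceDiag_isSymm hA y) (replaceDiag_isSymm hA x)).1
  rw [key x y hx, Finset.sum_sub_distrib] at hxy
  rw [key y x hy, Finset.sum_sub_distrib] at hyx
  exact replaceDiag_injective A (hxy.2 (by linarith))

/-- Along every orbit of the iteration the potential decrements tend to zero, the orbit stays in a
compact sublevel set, and all its cluster points have `diag e^{A[x]} = 1`. -/
theorem diagStep_orbit (hA : A.IsSymm) {x : ℕ → Fin n → ℝ}
    (hx : ∀ k, x (k + 1) = diagStep A (x k)) :
    (∀ k, x k ∈ {z | diagPotential A z ≤ diagPotential A (x 0)}) ∧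
    ∀ z, MapClusterPt z atTop x → ∀ i, NormedSpace.exp (replaceDiag A z) i i = 1 := by
  set h : (Fin n → ℝ) → ℝ := fun z => ∑ i, (NormedSpace.exp (replaceDiag A z) i i - 1 -
        Real.log (NormedSpace.exp (replaceDiag A z) i i)) with hh
  have hterm : ∀ z i, 0 ≤ NormedSpace.exp (replaceDiag A z) i i - 1 -
        Real.log (NormedSpace.exp (replaceDiag A z) i i) := fun z i =>
    sub_nonneg.2 (Real.log_le_sub_one_of_pos (exp_replaceDiag_diag_pos hA z i))
  have hnn : ∀ z, 0 ≤ h z := fun z => Finset.sum_nonneg fun i _ => hterm z i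
  have hdec : ∀ k, diagPotential A (x (k + 1)) ≤ diagPotential A (x k) - h (x k) := fun k => by
    rw [hx k]; exact diagPotential_diagStep_le hA (x k)
  have hanti : Antitone fun k => diagPotential A (x k) :=
    antitone_nat_of_succ_le fun k => (hdec k).trans (sub_le_self _ (hnn _))
  refine ⟨fun k => hanti (Nat.zero_le k), fun z hz => ?_⟩
  have hbdd : BddBelow (Set.range fun k => diagPotential A (x k)) := by
    refine ⟨0, ?_⟩
    rintro _ ⟨k, rfl⟩
    refine le_trans (Finset.sum_nonneg fun i _ => ?_) (sum_exp_sub_le_diagPotential hA (x k))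
    have := Real.add_one_le_exp (x k i)
    linarith
  have hlim := tendsto_atTop_ciInf hanti hbdd
  -- Each `h (x k)` is at most a successive difference of a convergent sequence.
  have hlim0 : Tendsto (fun k => h (x k)) atTop (𝓝 0) := by
    have h1 := hlim.sub (hlim.comp (tendsto_add_atTop_nat 1))
    rw [sub_self] at h1
    refine squeeze_zero (fun k => hnn _) (fun k => ?_) h1
    have := hdec k
    simp only [Function.comp_apply]
    linarith
  have hcont : Continuous h := by
    refine continuous_finsetSum _ fun i _ => ?_
    have hc : Continuous fun z => NormedSpace.exp (replaceDiag A z) i i :=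
      (continuous_exp_replaceDiag A).matrix_elem i i
    exact (hc.sub continuous_const).sub
      (hc.log fun z => (exp_replaceDiag_diag_pos hA z i).ne')
  have hhz : h z = 0 := by
    have hcl : MapClusterPt (h z) atTop (h ∘ x) := hz.continuousAt_comp hcont.continuousAt
    exact eq_of_nhds_neBot (hcl.neBot.mono (inf_le_inf_left _ hlim0))
  intro i
  have hi := (Finset.sum_eq_zero_iff_of_nonneg fun i _ => hterm z i).1 hhz i (Finset.mem_univ i)
  by_contra hne
  have := Real.log_lt_sub_one_of_pos (exp_replaceDiag_diag_pos hA z i) hne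
  linarith

theorem exists_forall_diagStep_tendsto (hA : A.IsSymm) :
    ∃ xstar : Fin n → ℝ,
      (∀ y : Fin n → ℝ,
        IsCorrelationMatrix (NormedSpace.exp (replaceDiag A y)) ↔ y = xstar) ∧
      ∀ x : ℕ → Fin n → ℝ, (∀ k, x (k + 1) = diagStep A (x k)) →
        Tendsto x atTop (𝓝 xstar) := by
  have hcpt := fun c => isCompact_diagPotential_le hA c
  obtain ⟨z, hz⟩ : ∃ z : Fin n → ℝ, ∀ i, NormedSpace.exp (replaceDiag A z) i i = 1 := by
    have horb := diagStep_orbit hA (x := fun k => (diagStep A)^[k] 0)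
      fun k => Function.iterate_succ_apply' _ _ _
    obtain ⟨z, -, hz⟩ := (hcpt _).exists_mapClusterPt_of_frequently
      (Frequently.of_forall (f := atTop) horb.1)
    exact ⟨z, horb.2 z hz⟩
  refine ⟨z, fun y => ?_, fun x hx => ?_⟩
  · rw [isCorrelationMatrix_exp_replaceDiag_iff hA]
    exact ⟨fun hy => eq_of_exp_replaceDiag_diag_eq_one hA hy hz, fun h => h ▸ hz⟩
  · have horb := diagStep_orbit hA hx
    exact (hcpt _).tendsto_nhds_of_unique_mapClusterPt (Eventually.of_forall horb.1)
      fun y _ hy => eq_of_exp_replaceDiag_diag_eq_one hA (horb.2 y hy) hz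

/-! ### Reconstruction of the correlation matrix -/

theorem exists_isSymm_vecl_eq (γ : LowerIndex n → ℝ) :
    ∃ A : Matrix (Fin n) (Fin n) ℝ, A.IsSymm ∧ vecl A = γ := by
  refine ⟨Matrix.of fun i j => if h : j < i then γ ⟨(i, j), h⟩ else
    if h : i < j then γ ⟨(j, i), h⟩ else 0, Matrix.IsSymm.ext fun i j => ?_, ?_⟩
  · simp only [Matrix.of_apply]
    rcases lt_trichotomy i j with h | h | h
    · simp [h, h.not_gt]
    · simp [h]
    · simp [h, h.not_gt]
  · ext ⟨⟨i, j⟩, h⟩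
    have h' : j < i := h
    simp [vecl, h']

theorem eq_replaceDiag_of_vecl_eq {S : Matrix (Fin n) (Fin n) ℝ} (hA : A.IsSymm) (hS : S.IsSymm)
    (h : vecl S = vecl A) : S = replaceDiag A S.diag := by
  have hlt : ∀ i j, j < i → S i j = A i j := fun i j hij => congrFun h ⟨(i, j), hij⟩
  ext i j
  rcases lt_trichotomy i j with hij | hij | hij
  · simp [replaceDiag, hij.ne, ← hS.apply i j, ← hA.apply i j, hlt j i hij]
  · simp [replaceDiag, hij]
  · simp [replaceDiag, hij.ne', hlt i j hij]

theorem vecl_replaceDiag (A : Matrix (Fin n) (Fin n) ℝ) (x : Fin n → ℝ) :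
    vecl (replaceDiag A x) = vecl A := by
  ext ⟨⟨i, j⟩, h⟩
  have h' : j < i := h
  simp [vecl, replaceDiag, h'.ne']

theorem matrixLog_isSymm (B : Matrix (Fin n) (Fin n) ℝ) : (matrixLog B).IsSymm := by
  have h : IsSelfAdjoint (matrixLog B) := cfc_predicate _ B
  rwa [IsSelfAdjoint, Matrix.star_eq_conjTranspose,
    Matrix.conjTranspose_eq_transpose_of_trivial] at h

/-- The logarithm of such a `B` is symmetric with the off-diagonal part of `A`, hence some `A[y]`,
and `hstar` forces `y = xstar`. -/
theorem mem_nonsingularCorrelationMatrices_gammaParam_iff (hA : A.IsSymm)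
    {xstar : Fin n → ℝ} (hstar : ∀ y : Fin n → ℝ,
      IsCorrelationMatrix (NormedSpace.exp (replaceDiag A y)) ↔ y = xstar)
    (B : Matrix (Fin n) (Fin n) ℝ) :
    (B ∈ nonsingularCorrelationMatrices n ∧ gammaParam B = vecl A) ↔
      B = NormedSpace.exp (replaceDiag A xstar) := by
  constructor
  · rintro ⟨⟨hB, hdet⟩, hγ⟩
    have hexp : NormedSpace.exp (matrixLog B) = B :=
      (hB.1.posDef_iff_det_ne_zero.2 hdet).exp_log
    have hS := eq_replaceDiag_of_vecl_eq hA (matrixLog_isSymm B) hγ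
    rw [← hexp, hS] at hB
    rw [← (hstar _).1 hB, ← hS, hexp]
  · rintro rfl
    have hS := replaceDiag_isSymm hA xstar
    refine ⟨⟨(hstar _).2 rfl, hS.posDef_exp.det_pos.ne'⟩, ?_⟩
    rw [gammaParam, matrixLog, hS.log_exp, vecl_replaceDiag]

theorem corollary1 (n : ℕ) :
    (∀ A : Matrix (Fin n) (Fin n) ℝ, A.IsSymm →
      ∃ xstar : Fin n → ℝ,
        (∀ y : Fin n → ℝ,
          IsCorrelationMatrix (NormedSpace.exp (replaceDiag A y)) ↔ y = xstar) ∧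
        ∀ x : ℕ → Fin n → ℝ, (∀ k, x (k + 1) = diagStep A (x k)) →
          Tendsto x atTop (𝓝 xstar)) ∧
    (∀ γ : LowerIndex n → ℝ,
      ∃ C : Matrix (Fin n) (Fin n) ℝ,
        (∀ B : Matrix (Fin n) (Fin n) ℝ,
          (B ∈ nonsingularCorrelationMatrices n ∧ gammaParam B = γ) ↔ B = C) ∧
        ∀ A : Matrix (Fin n) (Fin n) ℝ, A.IsSymm → vecl A = γ →
          ∀ x : ℕ → Fin n → ℝ, (∀ k, x (k + 1) = diagStep A (x k)) →
            Tendsto (fun k => NormedSpace.exp (replaceDiag A (x k))) atTop (𝓝 C)) := by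
  refine ⟨fun A hA => exists_forall_diagStep_tendsto hA, fun γ => ?_⟩
  obtain ⟨A, hA, rfl⟩ := exists_isSymm_vecl_eq γ
  obtain ⟨z, hz, -⟩ := exists_forall_diagStep_tendsto hA
  have hchar := mem_nonsingularCorrelationMatrices_gammaParam_iff hA hz
  refine ⟨_, hchar, fun A' hA' hγ x hx => ?_⟩
  -- The characterization of `C` depends on `A` only through `γ`, so `A'` leads to the same matrix.
  obtain ⟨z', hz', hlim⟩ := exists_forall_diagStep_tendsto hA'
  have hchar' := mem_nonsingularCorrelationMatrices_gammaParam_iff hA' hz'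
  rw [hγ] at hchar'
  rw [(hchar _).symm.trans (hchar' _) |>.1 rfl]
  exact ((continuous_exp_replaceDiag A').tendsto z').comp (hlim x hx)
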